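/- Let $(\mathcal S,\mathcal A,T,r,\gamma)$ be a discounted Markov decision process with finite non-empty state and action spaces $\mathcal S,\mathcal A$, transition kernel $T(s'\mid s,a)$, real-valued reward function $r(s,a)$ and discount factor $\gamma\in(0,1)$, and let $\pi(a\mid s)$ be a stationary behavior policy. Let $\mathcal X$ be the set of possible transitions $x=(s,a,s')$, i.e. those triples with $T(s'\mid s,a)>0$, and let $P$ be the transition matrix on $\mathcal X$ of the data stream $x_k=(s_k,a_k,s_{k+1})$ generated under $\pi$: $$P\big((s,a,s'),(u,b,u')\big)=\mathbf 1\{u=s'\}\,\pi(b\mid u)\,T(u'\mid u,b).$$ Suppose that $P$ is irreducible and aperiodic with stationary distribution $\mu_{\mathcal X}$, and that $(x_k)_{k\ge0}$ is a Markov chain with transition matrix $P$ and $x_0\sim\mu_{\mathcal X}$. Put $$\beta=1-(1-\gamma)\min_{(s,a)\in\mathcal S\times\mathcal A}\mu_{\mathcal S}(s,a),$$ where $\mu_{\mathcal S}(s,a)=\sum_{s'}\mu_{\mathcal X}(s,a,s')$ is the stationary distribution of $(s_k,a_k)_{k\ge0}$, and, for $\delta>0$, $$t_\delta=\min\Big\{k\ge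 0:\ \max_{x\in\mathcal X}\|P^k(x,\cdot)-\mu_{\mathcal X}\|_{TV}\le\delta\Big\}.$$ For a stepsize $\alpha>0$ let $(q^{[1]}_k)_{k\ge 0}$ and $(q^{[2]}_k)_{k\ge0}$ be two runs of Q-learning driven by the same data stream: for $i=1,2$, $$q^{[i]}_{k+1}(s_k,a_k)=q^{[i]}_k(s_k,a_k)+\alpha\Big(r(s_k,a_k)+\gamma\max_{v\in\mathcal A}q^{[i]}_k(s_{k+1},v)-q^{[i]}_k(s_k,a_k)\Big),$$ and $q^{[i]}_{k+1}(s,a)=q^{[i]}_k(s,a)$ for $(s,a)\ne(s_k,a_k)$. The random initial vectors $q_0^{[1]},q_0^{[2]}\in\mathbb R^{\mathcal S\times\mathcal A}$ may depend on each other and on $x_0$, but $(q_0^{[1]},q_0^{[2]})$ is independent of $(x_k)_{k\ge1}$ given $x_0$. Let $w_k=q^{[1]}_k-q^{[2]}_k$. There is a universal constant $c_0>0$ (independent of the decision process, the policy, the stepsize and the initial vectors) such that, whenever $t_\alpha\ge1$ and $$\alpha\,t_\alpha\le c_0\,\frac{(1-\beta)^2}{\log(|\mathcal S||\mathcal A|)},$$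 one has, for all $k\ge t_\alpha$, $$\mathbb E\big[\|w_k\|_\infty^2\big]\le 12\,\mathbb E\big[\|w_0\|_\infty^2\big]\Big(1-\frac{(1-\beta)\alpha}{2}\Big)^{k-t_\alpha}.$$ (Both expectations are in $[0,\infty]$. The condition $t_\alpha\ge1$ forces $|\mathcal S||\mathcal A|\ge2$, so the logarithm is positive.) -/

import Mathlib

open MeasureTheory ProbabilityTheory
open scoped ENNReal

noncomputable section

/-! ### Finite Markov chains -/

/-- A stationary probability distribution of the transition matrix `P`. -/
def IsStationaryDist {X : Type*} [Fintype X] (P : Matrix X X ℝ) (μ : X → ℝ) : Prop :=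
  μ ∈ stdSimplex ℝ X ∧ Matrix.vecMul μ P = μ

/-- Every state has period one: the greatest common divisor of its return times is `1`. -/
def IsAperiodic {X : Type*} [Fintype X] [DecidableEq X] (P : Matrix X X ℝ) : Prop :=
  ∀ x : X, ∀ d : ℕ, (∀ n : ℕ, 0 < n → 0 < (P ^ n) x x → d ∣ n) → d = 1

/-- Total variation distance between two distributions on a finite set. -/
def tvDist {X : Type*} [Fintype X] (μ ν : X → ℝ) : ℝ :=
  (1 / 2) * ∑ x, |μ x - ν x|

/-- `t_δ`: the first `k` with `max_x ‖P^k(x, ·) - μ‖_TV ≤ δ`. -/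
def mixingTime {X : Type*} [Fintype X] [DecidableEq X]
    (P : Matrix X X ℝ) (μ : X → ℝ) (δ : ℝ) : ℕ :=
  sInf {k : ℕ | ∀ x : X, tvDist ((P ^ k) x) μ ≤ δ}

/-- `x₀, x₁, …` is a time-homogeneous Markov chain with initial distribution `μ` and transition
matrix `P` under the probability `Pr`. -/
def IsMarkovChain {X : Type*} {Ω : Type*} [MeasurableSpace Ω] (Pr : Measure Ω)
    (P : Matrix X X ℝ) (μ : X → ℝ) (x : ℕ → Ω → X) : Prop :=
  ∀ (n : ℕ) (y : ℕ → X),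
    Pr {ω | ∀ i ≤ n, x i ω = y i} =
      ENNReal.ofReal (μ (y 0) * ∏ i ∈ Finset.range n, P (y i) (y (i + 1)))

/-! ### Discounted Markov decision processes -/

/-- A discounted Markov decision process on the state space `S` and action space `A`. -/
structure MDP (S A : Type*) [Fintype S] [Fintype A] where
  /-- `T s a s'` is the probability of moving to `s'` from `s` under action `a`. -/
  T : S → A → S → ℝ
  /-- reward function -/
  r : S → A → ℝ
  /-- discount factor -/
  γ : ℝ
  T_mem : ∀ s a, T s a ∈ stdSimplex ℝ S
  γ_pos : 0 < γ
  γ_lt_one : γ < 1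

/-- A stationary policy: `prob s a` is the probability of taking action `a` in state `s`. -/
structure Policy (S A : Type*) [Fintype A] where
  prob : S → A → ℝ
  prob_mem : ∀ s, prob s ∈ stdSimplex ℝ A

namespace MDP

variable {S A : Type*} [Fintype S] [Fintype A]

/-- The state space of the data stream: triples `x = (s, a, s')` that can occur as a transition.
(It is all of `S × A × S` exactly when every transition probability is positive; a triple of
probability zero cannot belong to an irreducible chain.) -/
def Transition (M : MDP S A) : Type _ :=
  {x : S × A × S // 0 < M.T x.1 x.2.1 x.2.2}

variable (M : MDP S A)

instance : Fintype M.Transition :=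
  inferInstanceAs (Fintype {x : S × A × S // 0 < M.T x.1 x.2.1 x.2.2})

instance [DecidableEq S] [DecidableEq A] : DecidableEq M.Transition :=
  inferInstanceAs (DecidableEq {x : S × A × S // 0 < M.T x.1 x.2.1 x.2.2})

/-- The discrete σ-algebra. -/
instance : MeasurableSpace M.Transition := ⊤

variable {M}

/-- The state `s` of `x = (s, a, s')`. -/
def Transition.state (x : M.Transition) : S := x.1.1

/-- The action `a` of `x = (s, a, s')`. -/
def Transition.action (x : M.Transition) : A := x.1.2.1

/-- The next state `s'` of `x = (s, a, s')`. -/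
def Transition.next (x : M.Transition) : S := x.1.2.2

variable (M)

/-- The transition matrix of the data stream `x_k = (s_k, a_k, s_{k+1})` generated by the
process under the behavior policy `π`. -/
def dataMatrix [DecidableEq S] (π : Policy S A) : Matrix M.Transition M.Transition ℝ :=
  fun x y =>
    if y.state = x.next then π.prob y.state y.action * M.T y.state y.action y.next else 0

/-- The transition matrix of the state-action chain `(s_k, a_k)` under the policy `π`. -/
def stateActionMatrix (π : Policy S A) : Matrix (S × A) (S × A) ℝ :=
  fun z z' => M.T z.1 z.2 z'.1 * π.prob z'.1 z'.2

/-- The law of `(s, a)` when `(s, a, s')` has law `μ`. -/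
def stateActionLaw [DecidableEq S] [DecidableEq A] (μ : M.Transition → ℝ) : S × A → ℝ :=
  fun z => ∑ x : M.Transition, if (x.state, x.action) = z then μ x else 0

/-- A sum weighted by `T` over possible transitions is the sum over all triples. -/
theorem sum_transition (g : S × A × S → ℝ) :
    ∑ y : M.Transition, g y.1 * M.T y.state y.action y.next
      = ∑ s, ∑ a, ∑ s', g (s, a, s') * M.T s a s' := by
  classical
  have h1 : ∑ y : M.Transition, g y.1 * M.T y.state y.action y.next
      = ∑ y ∈ Finset.univ.filter (fun y : S × A × S => 0 < M.T y.1 y.2.1 y.2.2),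
          g y * M.T y.1 y.2.1 y.2.2 :=
    (Finset.sum_subtype (p := fun y : S × A × S => 0 < M.T y.1 y.2.1 y.2.2) _
      (by simp) (fun y => g y * M.T y.1 y.2.1 y.2.2)).symm
  rw [h1, Finset.sum_filter_of_ne, Fintype.sum_prod_type]
  · simp only [Fintype.sum_prod_type]
  · intro y _ hy
    exact lt_of_le_of_ne ((M.T_mem y.1 y.2.1).1 y.2.2) (fun h => hy (by rw [← h, mul_zero]))

/-- The state-action law of a stationary data stream is a stationary distribution of the
state-action chain. -/
theorem isStationaryDist_stateActionLaw [DecidableEq S] [DecidableEq A] (π : Policy S A)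
    (μ : M.Transition → ℝ) (h : IsStationaryDist (M.dataMatrix π) μ) :
    IsStationaryDist (M.stateActionMatrix π) (M.stateActionLaw μ) := by
  obtain ⟨⟨h0, h1⟩, h2⟩ := h
  have law : ∀ f : S × A → ℝ, ∑ z, M.stateActionLaw μ z * f z
      = ∑ x : M.Transition, μ x * f (x.state, x.action) := by
    intro f
    simp only [stateActionLaw, Finset.sum_mul]
    rw [Finset.sum_comm]
    simp [ite_mul]
  -- stationarity, tested against functions
  have test : ∀ g : S × A × S → ℝ, ∑ y : M.Transition, μ y * g y.1
      = ∑ x : M.Transition, μ x *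
          ∑ a, ∑ s', g (x.next, a, s') * π.prob x.next a * M.T x.next a s' := by
    intro g
    have e : ∀ y, μ y = ∑ x : M.Transition, μ x * M.dataMatrix π x y := by
      intro y; exact (congrFun h2 y).symm
    calc ∑ y : M.Transition, μ y * g y.1
        = ∑ y : M.Transition, ∑ x : M.Transition, μ x * M.dataMatrix π x y * g y.1 := by
          refine Finset.sum_congr rfl fun y _ => ?_
          rw [← Finset.sum_mul, ← e y]
      _ = ∑ x : M.Transition, μ x * ∑ y : M.Transition,
            (g y.1 * (if y.1.1 = x.next then π.prob y.1.1 y.1.2.1 else 0))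
              * M.T y.state y.action y.next := by
          rw [Finset.sum_comm]
          refine Finset.sum_congr rfl fun x _ => ?_
          rw [Finset.mul_sum]
          refine Finset.sum_congr rfl fun y _ => ?_
          by_cases hy : y.state = x.next
          · rw [dataMatrix, if_pos hy, if_pos (show y.1.1 = x.next from hy)]
            simp only [Transition.state, Transition.action]
            ring
          · rw [dataMatrix, if_neg hy, if_neg (show ¬ y.1.1 = x.next from hy)]
            ring
      _ = _ := by
          refine Finset.sum_congr rfl fun x _ => ?_
          rw [M.sum_transition (fun y => g y * (if y.1 = x.next then π.prob y.1 y.2.1 else 0))]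
          congr 1
          rw [Finset.sum_eq_single x.next]
          · simp
          · intro s _ hs
            simp [hs]
          · simp
  have next : ∀ s', ∑ x : M.Transition, μ x * M.T x.state x.action s'
      = ∑ x : M.Transition, μ x * (if x.next = s' then 1 else 0) := by
    intro s'
    have t1 := test (fun y => M.T y.1 y.2.1 s')
    have t2 := test (fun y => if y.2.2 = s' then 1 else 0)
    simp only [Transition.state, Transition.action]
    rw [t1]
    refine Eq.trans ?_ t2.symm
    refine Finset.sum_congr rfl fun x _ => ?_
    congr 1
    refine Finset.sum_congr rfl fun a _ => ?_
    dsimp only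
    rw [← Finset.mul_sum, (M.T_mem x.next a).2]
    simp [ite_mul, mul_comm]
  refine ⟨⟨fun z => Finset.sum_nonneg fun x _ => ?_, ?_⟩, ?_⟩
  · split_ifs
    exacts [h0 x, le_rfl]
  · have := law (fun _ => 1)
    simpa [h1] using this
  · funext z
    have e1 : Matrix.vecMul (M.stateActionLaw μ) (M.stateActionMatrix π) z
        = (∑ x : M.Transition, μ x * M.T x.state x.action z.1) * π.prob z.1 z.2 := by
      have := law (fun w => M.T w.1 w.2 z.1 * π.prob z.1 z.2)
      refine Eq.trans this ?_
      rw [Finset.sum_mul]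
      exact Finset.sum_congr rfl fun x _ => by ring
    have e2 : M.stateActionLaw μ z = ∑ y : M.Transition, μ y *
        (if (y.1.1, y.1.2.1) = z then 1 else 0) := by
      refine Finset.sum_congr rfl fun y _ => ?_
      by_cases hy : (y.state, y.action) = z
      · rw [if_pos hy, if_pos (show (y.1.1, y.1.2.1) = z from hy), mul_one]
      · rw [if_neg hy, if_neg (show ¬ (y.1.1, y.1.2.1) = z from hy), mul_zero]
    rw [e1, e2, test (fun y => if (y.1, y.2.1) = z then 1 else 0), next, Finset.sum_mul]
    refine Finset.sum_congr rfl fun x _ => ?_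
    rw [mul_assoc]
    congr 1
    obtain ⟨s, a⟩ := z
    rw [Finset.sum_eq_single a]
    · by_cases hx : x.next = s
      · simp [hx, ← Finset.mul_sum, (M.T_mem s a).2]
      · simp [hx]
    · intro b _ hb
      simp [hb]
    · simp

/-- `β = 1 - (1 - γ) min_{(s,a)} μ_S(s, a)`, with `μ_S` the law of the state-action pair under
the stationary distribution `μ` of the data stream. -/
def contractionFactor [DecidableEq S] [DecidableEq A] [Nonempty S] [Nonempty A]
    (μ : M.Transition → ℝ) : ℝ :=
  1 - (1 - M.γ) * Finset.univ.inf' Finset.univ_nonempty (M.stateActionLaw μ)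

/-- The empirical Bellman operator `F(x, q)`: for `x = (s, a, s')` it equals
`r(s, a) + γ max_v q(s', v) - q(s, a)` at `(s, a)` and vanishes elsewhere. -/
def empiricalBellman [DecidableEq S] [DecidableEq A] [Nonempty A]
    (x : M.Transition) (q : S × A → ℝ) : S × A → ℝ :=
  fun z => if z = (x.state, x.action) then
      M.r x.state x.action
        + M.γ * Finset.univ.sup' Finset.univ_nonempty (fun v : A => q (x.next, v))
        - q (x.state, x.action)
    else 0

/-- Q-learning with constant stepsize `α`, data `x` and initial value `q₀`:
`q_{k+1} = q_k + α F(x_k, q_k)`. -/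
def qLearning [DecidableEq S] [DecidableEq A] [Nonempty A] (α : ℝ)
    (x : ℕ → M.Transition) (q₀ : S × A → ℝ) : ℕ → S × A → ℝ
  | 0 => q₀
  | k + 1 => qLearning α x q₀ k + α • M.empiricalBellman (x k) (qLearning α x q₀ k)

end MDP

end

/-! Both runs read the same data, so their difference obeys a pathwise comparison. Its sup norm
never grows. At a fixed pair `z`, each visit multiplies the excess of `|w(z)|` over `γ‖w₀‖` by at
most `1 - α`, so after `N` visits `|w(z)| ≤ (γ + (1 - γ)(1 - α)^N) ‖w₀‖` (`abs_qLearning_sub_le`).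
Randomness enters only through the visit counts.

Time is cut into blocks of length `n ≈ 1/(10α)`, which is long compared with the mixing time `t`.
Let `p` be the least stationary probability of a pair and `m = n - t`. If every pair is visited at
least `3/4` as often in a block as its stationary share of `m` steps, the block contracts the norm
by `1 - κ`, where `κ = (1 - γ)a(1 - a)` and `a = (3/4)αmp`. Otherwise nonexpansiveness is used. Both
cases are covered by the factor `1 - κ(1 - D)`, where `D` is a scaled sum of squared deviations of
the counts. It is affine in `D`, so only the mean of `D` is needed. Covariances of visit indicators
are small beyond lag `t`, hence `E[D] ≤ (128/p²)(t/m + α)` from every starting state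
(`pathExp_visitDeviation_le`), which is at most `1/10` under the stepsize condition. The mean factor
is then at most `ρ^n`, with `ρ = 1 - (1 - γ)pα/2` (`exists_block_length`).

This bound is uniform in the state at the start of the block, so the Markov property multiplies it
over blocks (`pathExp_blockProduct_le`). The same uniformity allows the initial vectors to depend on
`x₀`: the bound is applied after conditioning on `x₀` (`IsMarkovChain.lintegral_mul_le`). The
incomplete last block costs at most `ρ^(-n) ≤ 12`. -/

/-! ### Expectations over finite stretches of a path -/

section PathExpectation

variable {X : Type*}

/-- The path that starts at `y` and continues along `ξ`. -/
def pathCons (y : X) (ξ : ℕ → X) : ℕ → X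
  | 0 => y
  | i + 1 => ξ i

/-- The path `ξ` seen from time `m` on. -/
def pathShift (m : ℕ) (ξ : ℕ → X) : ℕ → X := fun i => ξ (m + i)

@[simp] theorem pathCons_zero (y : X) (ξ : ℕ → X) : pathCons y ξ 0 = y := rfl

@[simp] theorem pathCons_succ (y : X) (ξ : ℕ → X) (i : ℕ) : pathCons y ξ (i + 1) = ξ i := rfl

theorem pathShift_zero (ξ : ℕ → X) : pathShift 0 ξ = ξ := by
  funext i; simp [pathShift]

theorem pathShift_succ_pathCons (m : ℕ) (y : X) (ξ : ℕ → X) :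
    pathShift (m + 1) (pathCons y ξ) = pathShift m ξ := by
  funext i
  simp only [pathShift]
  rw [show m + 1 + i = (m + i) + 1 by omega, pathCons_succ]

theorem DependsOn.pathCons {g : (ℕ → X) → ℝ} {m : ℕ} (hg : DependsOn g (Set.Iic (m + 1)))
    (y : X) : DependsOn (fun ξ => g (pathCons y ξ)) (Set.Iic m) := by
  intro ξ ζ h
  apply hg
  rintro (_ | i) hi
  · rfl
  · exact h i (Nat.le_of_succ_le_succ hi)

theorem dependsOn_comp_apply (h : X → ℝ) {j m : ℕ} (hj : j ≤ m) :
    DependsOn (fun ξ : ℕ → X => h (ξ j)) (Set.Iic m) := by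
  intro ξ ζ e
  simp [e j hj]

variable [Fintype X]

/-- The expectation of `G (ξ₀, …, ξₙ, ξₙ, …)` for a chain `ξ` with transition matrix `P`
started at `y`. -/
def pathExp (P : Matrix X X ℝ) : ℕ → ((ℕ → X) → ℝ) → X → ℝ
  | 0, G, y => G fun _ => y
  | n + 1, G, y => ∑ y', P y y' * pathExp P n (fun ξ => G (pathCons y ξ)) y'

variable {P : Matrix X X ℝ}

theorem pathExp_add (n : ℕ) (G H : (ℕ → X) → ℝ) (y : X) :
    pathExp P n (fun ξ => G ξ + H ξ) y = pathExp P n G y + pathExp P n H y := by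
  induction n generalizing G H y with
  | zero => rfl
  | succ n ih => simp only [pathExp, ih, mul_add, Finset.sum_add_distrib]

theorem pathExp_const_mul (n : ℕ) (c : ℝ) (G : (ℕ → X) → ℝ) (y : X) :
    pathExp P n (fun ξ => c * G ξ) y = c * pathExp P n G y := by
  induction n generalizing G y with
  | zero => rfl
  | succ n ih =>
    simp only [pathExp, ih, Finset.mul_sum]
    exact Finset.sum_congr rfl fun _ _ => by ring

theorem pathExp_zero_fun (n : ℕ) (y : X) : pathExp P n (fun _ => 0) y = 0 := by
  simpa using pathExp_const_mul (P := P) n 0 (fun _ => 0) y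

theorem pathExp_sum {ι : Type*} (s : Finset ι) (n : ℕ) (G : ι → (ℕ → X) → ℝ) (y : X) :
    pathExp P n (fun ξ => ∑ i ∈ s, G i ξ) y = ∑ i ∈ s, pathExp P n (G i) y := by
  classical
  induction s using Finset.induction_on with
  | empty => simpa using pathExp_zero_fun n y
  | insert a s ha ih => simp only [Finset.sum_insert ha, pathExp_add, ih]

/-- The Markov property at time `m`. -/
theorem pathExp_mul_shift (m n : ℕ) {g : (ℕ → X) → ℝ} (hg : DependsOn g (Set.Iic m))
    (H : (ℕ → X) → ℝ) (y : X) :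
    pathExp P (m + n) (fun ξ => g ξ * H (pathShift m ξ)) y
      = pathExp P m (fun ξ => g ξ * pathExp P n H (ξ m)) y := by
  induction m generalizing g y with
  | zero =>
    -- At time `0` the factor `g` sees only the starting state, so it leaves the expectation as a
    -- constant.
    have key : ∀ K : (ℕ → X) → ℝ, pathExp P n (fun ξ => g ξ * K ξ) y
        = g (fun _ => y) * pathExp P n K y := by
      intro K
      cases n with
      | zero => rfl
      | succ n =>
        simp only [pathExp]
        rw [Finset.mul_sum]
        refine Finset.sum_congr rfl fun y' _ => ?_
        have : ∀ ξ, g (_root_.pathCons y ξ) = g fun _ => y := by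
          intro ξ
          apply hg
          intro i hi
          obtain rfl : i = 0 := by simpa using hi
          rfl
        simp only [this, pathExp_const_mul]
        ring
    rw [zero_add]
    simp only [pathShift_zero]
    exact key H
  | succ m ih =>
    rw [show m + 1 + n = (m + n) + 1 by omega]
    simp only [pathExp, pathShift_succ_pathCons, pathCons_succ]
    exact Finset.sum_congr rfl fun y' _ => by rw [ih (hg.pathCons y)]

variable [DecidableEq X]

theorem pathExp_mono (hP : P ∈ Matrix.rowStochastic ℝ X) (n : ℕ) {G H : (ℕ → X) → ℝ}
    (h : ∀ ξ, G ξ ≤ H ξ) (y : X) : pathExp P n G y ≤ pathExp P n H y := by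
  induction n generalizing G H y with
  | zero => exact h _
  | succ n ih =>
    exact Finset.sum_le_sum fun y' _ =>
      mul_le_mul_of_nonneg_left (ih (fun ξ => h _) y') (hP.1 y y')

theorem pathExp_nonneg (hP : P ∈ Matrix.rowStochastic ℝ X) (n : ℕ) {G : (ℕ → X) → ℝ}
    (h : ∀ ξ, 0 ≤ G ξ) (y : X) : 0 ≤ pathExp P n G y := by
  simpa [pathExp_zero_fun] using pathExp_mono hP n (G := fun _ => 0) h y

theorem pathExp_const (hP : P ∈ Matrix.rowStochastic ℝ X) (n : ℕ) (c : ℝ) (y : X) :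
    pathExp P n (fun _ => c) y = c := by
  induction n generalizing y with
  | zero => rfl
  | succ n ih =>
    simp only [pathExp, ih, ← Finset.sum_mul]
    rw [Matrix.sum_row_of_mem_rowStochastic hP, one_mul]

theorem pathExp_coord (hP : P ∈ Matrix.rowStochastic ℝ X) {j n : ℕ} (hj : j ≤ n)
    (h : X → ℝ) (y : X) : pathExp P n (fun ξ => h (ξ j)) y = ((P ^ j).mulVec h) y := by
  induction n generalizing j y with
  | zero =>
    obtain rfl : j = 0 := by omega
    simp [pathExp]
  | succ n ih =>
    cases j with
    | zero =>
      simp only [pathExp, pathCons_zero, pathExp_const hP, ← Finset.sum_mul]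
      rw [Matrix.sum_row_of_mem_rowStochastic hP]
      simp
    | succ j =>
      simp only [pathExp, pathCons_succ]
      rw [pow_succ', ← Matrix.mulVec_mulVec]
      exact Finset.sum_congr rfl fun y' _ => by rw [ih (by omega)]

/-- The Markov property at time `i` replaces `h (ξ j)` by its conditional mean given `ξ i`. -/
theorem pathExp_coord_mul_coord (hP : P ∈ Matrix.rowStochastic ℝ X) {i j n : ℕ} (hij : i ≤ j)
    (hj : j ≤ n) (g h : X → ℝ) (y : X) :
    pathExp P n (fun ξ => g (ξ i) * h (ξ j)) y
      = ((P ^ i).mulVec fun u => g u * ((P ^ (j - i)).mulVec h) u) y := by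
  have := pathExp_mul_shift (P := P) i (n - i) (dependsOn_comp_apply g le_rfl)
    (fun ξ => h (ξ (j - i))) y
  rw [show i + (n - i) = n by omega] at this
  simp only [pathShift, show i + (j - i) = j by omega] at this
  rw [this]
  simp only [pathExp_coord hP (show j - i ≤ n - i by omega)]
  exact pathExp_coord hP le_rfl (fun u => g u * ((P ^ (j - i)).mulVec h) u) y

end PathExpectation

/-! ### Second moments of occupation counts after mixing -/

section OccupationCount

variable {X : Type*} [Fintype X] {P : Matrix X X ℝ}

theorem abs_mulVec_sub_le_of_tvDist_le {μ : X → ℝ} {f : X → ℝ} (hf : ∀ u, |f u| ≤ 1) {δ : ℝ}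
    {y : X} (h : tvDist (P y) μ ≤ δ) : |(P.mulVec f) y - ∑ u, μ u * f u| ≤ 2 * δ := by
  have e : (P.mulVec f) y - ∑ u, μ u * f u = ∑ u, (P y u - μ u) * f u := by
    simp only [Matrix.mulVec, dotProduct, sub_mul, Finset.sum_sub_distrib]
  rw [e]
  calc |∑ u, (P y u - μ u) * f u| ≤ ∑ u, |(P y u - μ u) * f u| := Finset.abs_sum_le_sum_abs _ _
    _ ≤ ∑ u, |P y u - μ u| := Finset.sum_le_sum fun u _ => by
        rw [abs_mul]
        exact mul_le_of_le_one_right (abs_nonneg _) (hf u)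
    _ ≤ 2 * δ := by
        unfold tvDist at h
        linarith

variable [DecidableEq X]

theorem mulVec_mono_of_mem_rowStochastic (hP : P ∈ Matrix.rowStochastic ℝ X) {g h : X → ℝ}
    (hgh : ∀ u, g u ≤ h u) (y : X) : (P.mulVec g) y ≤ (P.mulVec h) y :=
  Finset.sum_le_sum fun u _ => mul_le_mul_of_nonneg_left (hgh u) (hP.1 y u)

theorem mulVec_const_of_mem_rowStochastic (hP : P ∈ Matrix.rowStochastic ℝ X) (c : ℝ) (y : X) :
    (P.mulVec fun _ => c) y = c := by
  simp only [Matrix.mulVec, dotProduct, ← Finset.sum_mul]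
  rw [Matrix.sum_row_of_mem_rowStochastic hP, one_mul]

/-- Mixing at time `t` persists: `P ^ i` averages the values of `(P ^ t) f`, all of which lie within
`2δ` of the stationary mean. -/
theorem abs_pow_mulVec_sub_le (hP : P ∈ Matrix.rowStochastic ℝ X) {μ f : X → ℝ}
    (hf : ∀ u, |f u| ≤ 1) {δ : ℝ} {t : ℕ} (hmix : ∀ y, tvDist ((P ^ t) y) μ ≤ δ) {i : ℕ}
    (hi : t ≤ i) (y : X) : |((P ^ i).mulVec f) y - ∑ u, μ u * f u| ≤ 2 * δ := by
  have hQ : P ^ (i - t) ∈ Matrix.rowStochastic ℝ X := pow_mem hP _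
  have e : (P ^ i).mulVec f = (P ^ (i - t)).mulVec ((P ^ t).mulVec f) := by
    rw [Matrix.mulVec_mulVec, ← pow_add, Nat.sub_add_cancel hi]
  have h := fun u => abs_le.1 (abs_mulVec_sub_le_of_tvDist_le hf (hmix u))
  set c := ∑ u, μ u * f u
  have h1 := mulVec_mono_of_mem_rowStochastic hQ (g := (P ^ t).mulVec f)
    (h := fun _ => c + 2 * δ) (fun u => by linarith [(h u).2]) y
  have h2 := mulVec_mono_of_mem_rowStochastic hQ (h := (P ^ t).mulVec f)
    (g := fun _ => c - 2 * δ) (fun u => by linarith [(h u).1]) y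
  rw [mulVec_const_of_mem_rowStochastic hQ] at h1 h2
  rw [e, abs_le]
  constructor <;> linarith

section Moments

variable {μ f : X → ℝ} {δ e : ℝ} {t : ℕ}

/-- After time `t` the mean of `|f - e| ≤ f + e` is at most `2e + 2δ ≤ 4e`. At lags below `t` the
second factor is bounded by `1`. At larger lags its conditional mean given `ξ i` is at most `2δ` in
absolute value. Keeping the factor `e`, rather than bounding by a constant, saves a power of `p`
later. -/
theorem pathExp_mul_centered_le_of_le (hP : P ∈ Matrix.rowStochastic ℝ X)
    (hf0 : ∀ u, 0 ≤ f u) (hf1 : ∀ u, f u ≤ 1) (he : ∑ u, μ u * f u = e)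
    (hmix : ∀ y, tvDist ((P ^ t) y) μ ≤ δ) (hδ : 0 ≤ δ) (hδe : δ ≤ e) (he1 : e ≤ 1)
    {i j n : ℕ} (hti : t ≤ i) (hij : i ≤ j) (hjn : j ≤ n) (y : X) :
    pathExp P n (fun ξ => (f (ξ i) - e) * (f (ξ j) - e)) y
      ≤ 8 * δ * e + if j < i + t then 4 * e else 0 := by
  have hf : ∀ u, |f u| ≤ 1 := fun u => abs_le.2 ⟨by linarith [hf0 u], hf1 u⟩
  have habs : ∀ u, |f u - e| ≤ f u + e := fun u =>
    abs_le.2 ⟨by linarith [hf0 u], by linarith⟩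
  have habs1 : ∀ u, |f u - e| ≤ 1 := fun u =>
    abs_le.2 ⟨by linarith [hf0 u], by linarith [hf1 u]⟩
  have hPi : P ^ i ∈ Matrix.rowStochastic ℝ X := pow_mem hP _
  have hone : ((P ^ i).mulVec fun u => f u + e) y ≤ 4 * e := by
    have h1 := (abs_le.1 (abs_pow_mulVec_sub_le hP hf hmix hti y)).2
    have h2 := mulVec_const_of_mem_rowStochastic hPi e y
    have h3 : ((P ^ i).mulVec fun u => f u + e) y
        = ((P ^ i).mulVec f) y + ((P ^ i).mulVec fun _ => e) y := by
      simp only [Matrix.mulVec, dotProduct, mul_add, Finset.sum_add_distrib]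
    rw [he] at h1
    rw [h3, h2]
    linarith
  have h8 : 0 ≤ 8 * δ * e := by have : 0 ≤ e := hδ.trans hδe; positivity
  split_ifs with hnear
  · have h1 : pathExp P n (fun ξ => (f (ξ i) - e) * (f (ξ j) - e)) y
        ≤ pathExp P n (fun ξ => (fun u => f u + e) (ξ i)) y := by
      refine pathExp_mono hP n (fun ξ => ?_) y
      calc (f (ξ i) - e) * (f (ξ j) - e) ≤ |f (ξ i) - e| * |f (ξ j) - e| := by
            rw [← abs_mul]; exact le_abs_self _
        _ ≤ |f (ξ i) - e| := mul_le_of_le_one_right (abs_nonneg _) (habs1 _)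
        _ ≤ _ := habs _
    rw [pathExp_coord hP (hij.trans hjn) (fun u => f u + e)] at h1
    linarith
  · rw [pathExp_coord_mul_coord hP hij hjn (fun u => f u - e) (fun u => f u - e)]
    have hPj : P ^ (j - i) ∈ Matrix.rowStochastic ℝ X := pow_mem hP _
    have hfar : ∀ u, |((P ^ (j - i)).mulVec fun u => f u - e) u| ≤ 2 * δ := by
      intro u
      have h1 := abs_pow_mulVec_sub_le hP hf hmix (show t ≤ j - i by omega) u
      have h2 := mulVec_const_of_mem_rowStochastic hPj e u
      have h3 : ((P ^ (j - i)).mulVec fun u => f u - e) u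
          = ((P ^ (j - i)).mulVec f) u - ((P ^ (j - i)).mulVec fun _ => e) u := by
        simp only [Matrix.mulVec, dotProduct, mul_sub, Finset.sum_sub_distrib]
      rwa [h3, h2, ← he]
    have h1 := mulVec_mono_of_mem_rowStochastic hPi
      (g := fun u => (f u - e) * ((P ^ (j - i)).mulVec fun u => f u - e) u)
      (h := fun u => 2 * δ * (f u + e)) (fun u => by
        calc _ ≤ |f u - e| * |((P ^ (j - i)).mulVec fun u => f u - e) u| := by
              rw [← abs_mul]; exact le_abs_self _
          _ ≤ (f u + e) * (2 * δ) :=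
              mul_le_mul (habs u) (hfar u) (abs_nonneg _) ((abs_nonneg _).trans (habs u))
          _ = _ := by ring) y
    have h2 : ((P ^ i).mulVec fun u => 2 * δ * (f u + e)) y
        = 2 * δ * ((P ^ i).mulVec fun u => f u + e) y := by
      simp only [Matrix.mulVec, dotProduct, Finset.mul_sum]
      exact Finset.sum_congr rfl fun u _ => by ring
    rw [h2] at h1
    have h3 : 2 * δ * ((P ^ i).mulVec fun u => f u + e) y ≤ 2 * δ * (4 * e) :=
      mul_le_mul_of_nonneg_left hone (by linarith)
    linarith

theorem pathExp_mul_centered_le (hP : P ∈ Matrix.rowStochastic ℝ X)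
    (hf0 : ∀ u, 0 ≤ f u) (hf1 : ∀ u, f u ≤ 1) (he : ∑ u, μ u * f u = e)
    (hmix : ∀ y, tvDist ((P ^ t) y) μ ≤ δ) (hδ : 0 ≤ δ) (hδe : δ ≤ e) (he1 : e ≤ 1)
    {i j n : ℕ} (hi : i ∈ Finset.Ico t n) (hj : j ∈ Finset.Ico t n) (y : X) :
    pathExp P n (fun ξ => (f (ξ i) - e) * (f (ξ j) - e)) y
      -- The interval is `|i - j| < t`; since `t ≤ i`, the natural subtraction does not truncate.
      ≤ 8 * δ * e + if j ∈ Finset.Ico (i + 1 - t) (i + t) then 4 * e else 0 := by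
  rw [Finset.mem_Ico] at hi hj
  have he0 : 0 ≤ e := hδ.trans hδe
  rcases le_total i j with hij | hij
  · refine (pathExp_mul_centered_le_of_le hP hf0 hf1 he hmix hδ hδe he1 hi.1 hij hj.2.le y).trans
      (add_le_add_right ?_ _)
    simp only [Finset.mem_Ico]
    split_ifs <;> first | omega | linarith
  · have := pathExp_mul_centered_le_of_le hP hf0 hf1 he hmix hδ hδe he1 hj.1 hij hi.2.le y
    have hc : (fun ξ : ℕ → X => (f (ξ i) - e) * (f (ξ j) - e))
        = fun ξ => (f (ξ j) - e) * (f (ξ i) - e) := funext fun ξ => mul_comm _ _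
    rw [hc]
    refine this.trans (add_le_add_right ?_ _)
    simp only [Finset.mem_Ico]
    split_ifs <;> first | omega | linarith

/-- The centred occupation count of `f` over `[t, n)` has a second moment of the order
`(n - t) t + (n - t)² δ`, whatever the starting state. -/
theorem pathExp_sq_centered_count_le (hP : P ∈ Matrix.rowStochastic ℝ X)
    (hf0 : ∀ u, 0 ≤ f u) (hf1 : ∀ u, f u ≤ 1) (he : ∑ u, μ u * f u = e)
    (hmix : ∀ y, tvDist ((P ^ t) y) μ ≤ δ) (hδ : 0 ≤ δ) (hδe : δ ≤ e) (he1 : e ≤ 1)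
    (n : ℕ) (y : X) :
    pathExp P n (fun ξ => (∑ i ∈ Finset.Ico t n, (f (ξ i) - e)) ^ 2) y
      ≤ 8 * e * ((n - t : ℕ) * t + (n - t : ℕ) ^ 2 * δ) := by
  have he0 : 0 ≤ e := hδ.trans hδe
  simp only [sq (∑ i ∈ Finset.Ico t n, (f (_ : X) - e)), Finset.sum_mul_sum]
  simp only [pathExp_sum]
  have hrow : ∀ i ∈ Finset.Ico t n, ∑ j ∈ Finset.Ico t n,
      pathExp P n (fun ξ => (f (ξ i) - e) * (f (ξ j) - e)) y
        ≤ (n - t : ℕ) * (8 * δ * e) + 2 * t * (4 * e) := by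
    intro i hi
    refine (Finset.sum_le_sum fun j hj =>
      pathExp_mul_centered_le hP hf0 hf1 he hmix hδ hδe he1 hi hj y).trans ?_
    rw [Finset.sum_add_distrib, Finset.sum_const, Nat.card_Ico, nsmul_eq_mul]
    refine add_le_add_right ?_ _
    rw [← Finset.sum_filter, Finset.sum_const, nsmul_eq_mul]
    refine mul_le_mul_of_nonneg_right ?_ (by linarith)
    have : ((Finset.Ico t n).filter (· ∈ Finset.Ico (i + 1 - t) (i + t))).card ≤ 2 * t := by
      refine (Finset.card_le_card (t := Finset.Ico (i + 1 - t) (i + t)) ?_).trans ?_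
      · intro j hj
        exact (Finset.mem_filter.1 hj).2
      · rw [Nat.card_Ico]
        omega
    exact_mod_cast this
  refine (Finset.sum_le_sum hrow).trans (le_of_eq ?_)
  rw [Finset.sum_const, Nat.card_Ico, nsmul_eq_mul]
  ring

end Moments

end OccupationCount

/-! ### Pathwise contraction of coupled Q-learning -/

theorem Finset.abs_sup'_sub_sup'_le {ι : Type*} {s : Finset ι} (hs : s.Nonempty)
    {f g : ι → ℝ} {C : ℝ} (h : ∀ i ∈ s, |f i - g i| ≤ C) : |s.sup' hs f - s.sup' hs g| ≤ C := by
  have key : ∀ f g : ι → ℝ, (∀ i ∈ s, f i - g i ≤ C) → s.sup' hs f ≤ C + s.sup' hs g := by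
    intro f g h
    refine Finset.sup'_le hs f fun i hi => ?_
    linarith [h i hi, Finset.le_sup' g hi]
  have h1 := key f g fun i hi => (abs_le.1 (h i hi)).2
  have h2 := key g f fun i hi => by linarith [(abs_le.1 (h i hi)).1]
  rw [abs_le]
  constructor <;> linarith

/-- Since `(1 - α)(1 + α) ≤ 1`, Bernoulli gives `(1 - α)^N ≤ 1/(1 + a)`, and `(1 - a + a²)(1 + a) =
1 + a³ ≥ 1`. -/
theorem one_sub_pow_le_of_le_mul {α a : ℝ} (h0 : 0 ≤ α) (h1 : α ≤ 1) (ha : 0 ≤ a) {N : ℕ}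
    (haN : a ≤ α * N) : (1 - α) ^ N ≤ 1 - a * (1 - a) := by
  have hb : 1 + a ≤ (1 + α) ^ N := by
    have := one_add_mul_le_pow (show (-2 : ℝ) ≤ α by linarith) N
    linarith
  have hp : 0 ≤ (1 - α) ^ N := pow_nonneg (by linarith) N
  have hprod : (1 - α) ^ N * (1 + α) ^ N ≤ 1 := by
    rw [← mul_pow]
    exact pow_le_one₀ (by nlinarith) (by nlinarith)
  have h2 : (1 - α) ^ N * (1 + a) ≤ 1 := (mul_le_mul_of_nonneg_left hb hp).trans hprod
  have h3 : (1 : ℝ) ≤ (1 - a * (1 - a)) * (1 + a) := by nlinarith [pow_nonneg ha 3]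
  exact le_of_mul_le_mul_right (h2.trans h3) (by linarith)

namespace MDP

section Pathwise

variable {S A : Type*} [Fintype S] [Fintype A] [DecidableEq S] [DecidableEq A] {M : MDP S A}

/-- The indicator of the transitions out of the state-action pair `z`. -/
def visit (z : S × A) (x : M.Transition) : ℝ :=
  if (x.state, x.action) = z then 1 else 0

/-- The number of visits to the state-action pair `z` during `[0, n)`. -/
def visitCount (ξ : ℕ → M.Transition) (z : S × A) (n : ℕ) : ℕ :=
  ((Finset.range n).filter fun i => ((ξ i).state, (ξ i).action) = z).card

theorem visitCount_succ (ξ : ℕ → M.Transition) (z : S × A) (n : ℕ) :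
    visitCount ξ z (n + 1)
      = visitCount ξ z n + if ((ξ n).state, (ξ n).action) = z then 1 else 0 := by
  unfold visitCount
  rw [Finset.range_add_one, Finset.filter_insert]
  split_ifs
  · rw [Finset.card_insert_of_notMem (by simp)]
  · rw [add_zero]

theorem sum_visit_le_visitCount (ξ : ℕ → M.Transition) (z : S × A) (t n : ℕ) :
    ∑ i ∈ Finset.Ico t n, visit z (ξ i) ≤ visitCount ξ z n := by
  simp only [visit, Finset.sum_boole, visitCount]
  refine Nat.cast_le.2 (Finset.card_le_card (Finset.filter_subset_filter _ fun i hi => ?_))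
  exact Finset.mem_range.2 (Finset.mem_Ico.1 hi).2

/-- The sum over all pairs `z` of the squared relative deviation of the number of visits to `z`
during `[t, n)` from `(n - t) ν z`, scaled so that a value below `1` makes every relative deviation
less than `1 / 4`. -/
noncomputable def visitDeviation (ν : S × A → ℝ) (t n : ℕ) (ξ : ℕ → M.Transition) : ℝ :=
  ∑ z, 16 / ((n - t : ℕ) * ν z) ^ 2 * (∑ i ∈ Finset.Ico t n, (visit z (ξ i) - ν z)) ^ 2

theorem visitDeviation_nonneg (ν : S × A → ℝ) (t n : ℕ) (ξ : ℕ → M.Transition) :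
    0 ≤ visitDeviation ν t n ξ :=
  Finset.sum_nonneg fun z _ => by positivity

theorem le_visitCount_of_visitDeviation_lt_one {ν : S × A → ℝ} (hν : ∀ z, 0 < ν z) {t n : ℕ}
    (htn : t < n) {ξ : ℕ → M.Transition} (h : visitDeviation ν t n ξ < 1) (z : S × A) :
    3 / 4 * ((n - t : ℕ) * ν z) ≤ visitCount ξ z n := by
  have hm : (0 : ℝ) < (n - t : ℕ) := by exact_mod_cast Nat.sub_pos_of_lt htn
  have hmν : 0 < (n - t : ℕ) * ν z := mul_pos hm (hν z)
  have h1 : 16 / ((n - t : ℕ) * ν z) ^ 2 * (∑ i ∈ Finset.Ico t n, (visit z (ξ i) - ν z)) ^ 2 < 1 :=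
    (Finset.single_le_sum (f := fun z => 16 / ((n - t : ℕ) * ν z) ^ 2 *
      (∑ i ∈ Finset.Ico t n, (visit z (ξ i) - ν z)) ^ 2)
      (fun z _ => by positivity) (Finset.mem_univ z)).trans_lt h
  have h2 : ∑ i ∈ Finset.Ico t n, (visit z (ξ i) - ν z)
      = ∑ i ∈ Finset.Ico t n, visit z (ξ i) - (n - t : ℕ) * ν z := by
    rw [Finset.sum_sub_distrib, Finset.sum_const, Nat.card_Ico, nsmul_eq_mul]
  rw [h2, div_mul_eq_mul_div, div_lt_one (by positivity)] at h1
  have h3 := sum_visit_le_visitCount ξ z t n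
  set V := ∑ i ∈ Finset.Ico t n, visit z (ξ i)
  have h4 : |4 * (V - (n - t : ℕ) * ν z)| < (n - t : ℕ) * ν z := by
    apply abs_lt_of_sq_lt_sq _ hmν.le
    linarith [h1]
  linarith [(abs_lt.1 h4).1]

/-- The bound for the contraction of `‖·‖²` over a block of length `n`: `1 - κ` when every pair is
visited about as often as it should be, and at least `1` otherwise. -/
noncomputable def blockFactor (κ : ℝ) (ν : S × A → ℝ) (t n : ℕ) (ξ : ℕ → M.Transition) : ℝ :=
  1 - κ * (1 - visitDeviation ν t n ξ)

theorem blockFactor_nonneg {κ : ℝ} (h0 : 0 ≤ κ) (h1 : κ ≤ 1) (ν : S × A → ℝ) (t n : ℕ)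
    (ξ : ℕ → M.Transition) : 0 ≤ blockFactor κ ν t n ξ := by
  unfold blockFactor
  nlinarith [visitDeviation_nonneg ν t n ξ]

variable [Nonempty A] {α : ℝ}

theorem qLearning_add (ξ : ℕ → M.Transition) (q : S × A → ℝ) (n k : ℕ) :
    M.qLearning α ξ q (n + k) = M.qLearning α (pathShift n ξ) (M.qLearning α ξ q n) k := by
  induction k with
  | zero => rfl
  | succ k ih => rw [← add_assoc, qLearning, qLearning, ih]; rfl

theorem abs_qLearning_sub_succ_le (h0 : 0 ≤ α) (h1 : α ≤ 1) (ξ : ℕ → M.Transition)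
    (q q' : S × A → ℝ) (k : ℕ) {C : ℝ}
    (hC : ∀ z, |M.qLearning α ξ q k z - M.qLearning α ξ q' k z| ≤ C) (z : S × A) :
    |M.qLearning α ξ q (k + 1) z - M.qLearning α ξ q' (k + 1) z|
      ≤ if ((ξ k).state, (ξ k).action) = z
        then (1 - α) * |M.qLearning α ξ q k z - M.qLearning α ξ q' k z| + α * (M.γ * C)
        else |M.qLearning α ξ q k z - M.qLearning α ξ q' k z| := by
  simp only [qLearning, Pi.add_apply, Pi.smul_apply, smul_eq_mul, empiricalBellman]
  set u := M.qLearning α ξ q k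
  set u' := M.qLearning α ξ q' k
  by_cases hz : ((ξ k).state, (ξ k).action) = z
  · rw [if_pos hz.symm, if_pos hz.symm, if_pos hz, hz]
    have hs := Finset.abs_sup'_sub_sup'_le (Finset.univ_nonempty (α := A))
      (f := fun v => u ((ξ k).next, v)) (g := fun v => u' ((ξ k).next, v)) fun v _ => hC _
    set s := Finset.univ.sup' Finset.univ_nonempty fun v => u ((ξ k).next, v)
    set s' := Finset.univ.sup' Finset.univ_nonempty fun v => u' ((ξ k).next, v)
    rw [show ∀ r : ℝ, u z + α * (r + M.γ * s - u z) - (u' z + α * (r + M.γ * s' - u' z))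
      = (1 - α) * (u z - u' z) + α * (M.γ * (s - s')) from fun r => by ring]
    refine (abs_add_le _ _).trans ?_
    rw [abs_mul, abs_mul, abs_mul, abs_of_nonneg h0, abs_of_pos M.γ_pos,
      abs_of_nonneg (sub_nonneg.2 h1)]
    have := M.γ_pos.le
    gcongr
  · rw [if_neg hz, if_neg fun h => hz h.symm, if_neg fun h => hz h.symm]
    simp

/-- With `C = ‖q - q'‖`, a visit applies at worst the map `u ↦ (1 - α)u + αγC`, which contracts
towards its fixed point `γC`; the initial excess over it is at most `(1 - γ)C`. The induction
hypothesis itself supplies the uniform bound `C` needed for the maxima at the next state. -/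
theorem abs_qLearning_sub_le (h0 : 0 ≤ α) (h1 : α ≤ 1) (ξ : ℕ → M.Transition)
    (q q' : S × A → ℝ) (k : ℕ) (z : S × A) :
    |M.qLearning α ξ q k z - M.qLearning α ξ q' k z|
      ≤ (M.γ + (1 - M.γ) * (1 - α) ^ visitCount ξ z k) * ‖q - q'‖ := by
  have hγ0 := M.γ_pos
  have hγ1 := M.γ_lt_one
  induction k generalizing z with
  | zero =>
    simpa [visitCount, qLearning] using norm_le_pi_norm (q - q') z
  | succ k ih =>
    have hC : ∀ z, |M.qLearning α ξ q k z - M.qLearning α ξ q' k z| ≤ ‖q - q'‖ := by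
      intro z
      refine (ih z).trans (mul_le_of_le_one_left (norm_nonneg _) ?_)
      have : (1 - α) ^ visitCount ξ z k ≤ 1 := pow_le_one₀ (by linarith) (by linarith)
      nlinarith
    refine (abs_qLearning_sub_succ_le h0 h1 ξ q q' k hC z).trans ?_
    rw [visitCount_succ]
    split_ifs with hz
    · have := mul_le_mul_of_nonneg_left (ih z) (sub_nonneg.2 h1)
      rw [pow_succ]
      linarith
    · exact ih z

theorem norm_qLearning_sub_le (h0 : 0 ≤ α) (h1 : α ≤ 1) (ξ : ℕ → M.Transition)
    (q q' : S × A → ℝ) (k : ℕ) : ‖M.qLearning α ξ q k - M.qLearning α ξ q' k‖ ≤ ‖q - q'‖ := by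
  refine (pi_norm_le_iff_of_nonneg (norm_nonneg _)).2 fun z => ?_
  refine (abs_qLearning_sub_le h0 h1 ξ q q' k z).trans (mul_le_of_le_one_left (norm_nonneg _) ?_)
  have : (1 - α) ^ visitCount ξ z k ≤ 1 := pow_le_one₀ (by linarith) (by linarith)
  nlinarith [M.γ_pos, M.γ_lt_one]

theorem norm_qLearning_sub_sq_le_blockFactor (h0 : 0 ≤ α) (h1 : α ≤ 1) {ν : S × A → ℝ} {p a : ℝ}
    (hp : 0 < p) (hν : ∀ z, p ≤ ν z) {t n : ℕ} (htn : t < n)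
    (ha : a = α * (3 / 4 * ((n - t : ℕ) * p))) (ha1 : a ≤ 1) (ξ : ℕ → M.Transition)
    (q q' : S × A → ℝ) :
    ‖M.qLearning α ξ q n - M.qLearning α ξ q' n‖ ^ 2
      ≤ blockFactor ((1 - M.γ) * (a * (1 - a))) ν t n ξ * ‖q - q'‖ ^ 2 := by
  have hγ := sub_pos.2 M.γ_lt_one
  have ha0 : 0 ≤ a := by rw [ha]; positivity
  have hκ : 0 ≤ (1 - M.γ) * (a * (1 - a)) :=
    mul_nonneg hγ.le (mul_nonneg ha0 (sub_nonneg.2 ha1))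
  have hle := norm_qLearning_sub_le h0 h1 ξ q q' n
  have hD0 := visitDeviation_nonneg ν t n ξ
  have key : ‖M.qLearning α ξ q n - M.qLearning α ξ q' n‖
      ≤ blockFactor ((1 - M.γ) * (a * (1 - a))) ν t n ξ * ‖q - q'‖ := by
    rcases lt_or_ge (visitDeviation ν t n ξ) 1 with hD | hD
    · have hf : 1 - (1 - M.γ) * (a * (1 - a))
          ≤ blockFactor ((1 - M.γ) * (a * (1 - a))) ν t n ξ := by
        unfold blockFactor
        nlinarith
      refine le_trans ?_ (mul_le_mul_of_nonneg_right hf (norm_nonneg _))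
      have hf0 : 0 ≤ 1 - (1 - M.γ) * (a * (1 - a)) := by
        have : a * (1 - a) ≤ 1 := by nlinarith
        nlinarith [M.γ_pos]
      refine (pi_norm_le_iff_of_nonneg (mul_nonneg hf0 (norm_nonneg _))).2 fun z => ?_
      refine (abs_qLearning_sub_le h0 h1 ξ q q' n z).trans
        (mul_le_mul_of_nonneg_right ?_ (norm_nonneg _))
      have hN := le_visitCount_of_visitDeviation_lt_one
        (fun z => hp.trans_le (hν z)) htn hD z
      have haN : a ≤ α * visitCount ξ z n := by
        rw [ha]
        refine mul_le_mul_of_nonneg_left (le_trans ?_ hN) h0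
        have := hν z
        gcongr
      have := mul_le_mul_of_nonneg_left (one_sub_pow_le_of_le_mul h0 h1 ha0 haN) hγ.le
      linarith
    · refine hle.trans (le_mul_of_one_le_left (norm_nonneg _) ?_)
      unfold blockFactor
      nlinarith
  -- Only one of the two factors is contracted, the other being merely nonexpansive. This keeps the
  -- bound affine in the deviation, so no fourth moments of the counts arise.
  calc ‖M.qLearning α ξ q n - M.qLearning α ξ q' n‖ ^ 2
      ≤ ‖M.qLearning α ξ q n - M.qLearning α ξ q' n‖ * ‖q - q'‖ := by
        rw [sq]; exact mul_le_mul_of_nonneg_left hle (norm_nonneg _)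
    _ ≤ _ := by
        rw [sq, ← mul_assoc]
        exact mul_le_mul_of_nonneg_right key (norm_nonneg _)

end Pathwise

end MDP

/-! ### Functionals of a Markov chain and its initial data -/

section Transfer

variable {X : Type*}

/-- The path that follows `y` up to time `j - 1` and then `ξ`. -/
def pathGlue (j : ℕ) (y ξ : ℕ → X) : ℕ → X := fun i => if i < j then y i else ξ (i - j)

theorem pathGlue_pathCons (j : ℕ) (y ξ : ℕ → X) (v : X) :
    pathGlue j y (pathCons (y j) ξ) = pathGlue (j + 1) (Function.update y (j + 1) v) ξ := by
  funext i
  unfold pathGlue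
  rcases lt_trichotomy i j with h | rfl | h
  · rw [if_pos h, if_pos (by omega), Function.update_of_ne (by omega)]
  · rw [if_neg (lt_irrefl _), if_pos (by omega), Function.update_of_ne (by omega), Nat.sub_self,
      pathCons_zero]
  · rw [if_neg (by omega), if_neg (by omega), show i - j = (i - (j + 1)) + 1 by omega,
      pathCons_succ]

variable {Ω : Type*} [MeasurableSpace Ω] {Pr : Measure Ω} {P : Matrix X X ℝ} {μ : X → ℝ}
  {x : ℕ → Ω → X}

theorem IsMarkovChain.measure_start (hM : IsMarkovChain Pr P μ x) (y : X) :
    Pr (x 0 ⁻¹' {y}) = ENNReal.ofReal (μ y) := by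
  have hset : {ω | ∀ i ≤ 0, x i ω = y} = x 0 ⁻¹' {y} := by
    ext ω
    simp
  rw [← hset, hM 0 fun _ => y]
  simp

variable [Fintype X] [MeasurableSpace X] [DiscreteMeasurableSpace X]

theorem measurableSet_path_prefix (hx : ∀ k, Measurable (x k)) (j : ℕ) (y : ℕ → X) :
    MeasurableSet {ω | ∀ i ≤ j, x i ω = y i} := by
  simp only [Set.ofPred_forall]
  exact MeasurableSet.iInter fun i => MeasurableSet.iInter fun _ =>
    hx i (measurableSet_singleton (y i))

variable [DecidableEq X]

/-- Induction on the number `d` of unrevealed steps: the prefix event splits according to the next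
state, and once `d = 0` the functional is constant on it. -/
theorem IsMarkovChain.setLIntegral_prefix (hM : IsMarkovChain Pr P μ x)
    (hx : ∀ k, Measurable (x k)) (hP : P ∈ Matrix.rowStochastic ℝ X) (hμ : ∀ y, 0 ≤ μ y)
    {G : (ℕ → X) → ℝ} (hG0 : ∀ ξ, 0 ≤ G ξ) (d j : ℕ) (hG : DependsOn G (Set.Iic (j + d)))
    (y : ℕ → X) :
    ∫⁻ ω in {ω | ∀ i ≤ j, x i ω = y i}, ENNReal.ofReal (G fun k => x k ω) ∂Pr
      = ENNReal.ofReal ((μ (y 0) * ∏ i ∈ Finset.range j, P (y i) (y (i + 1))) *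
          pathExp P d (fun ξ => G (pathGlue j y ξ)) (y j)) := by
  induction d generalizing j y with
  | zero =>
    have e : ∀ ω ∈ {ω | ∀ i ≤ j, x i ω = y i}, ENNReal.ofReal (G fun k => x k ω)
        = ENNReal.ofReal (G (pathGlue j y fun _ => y j)) := by
      intro ω hω
      congr 1
      apply hG
      intro i hi
      have hij : i ≤ j := by simpa using hi
      rw [hω i hij]
      unfold pathGlue
      split_ifs with h
      · rfl
      · rw [show i = j by omega]
    rw [setLIntegral_congr_fun (measurableSet_path_prefix hx j y) e, setLIntegral_const, hM j y,
      pathExp, ← ENNReal.ofReal_mul (hG0 _), mul_comm]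
  | succ d ih =>
    have hset : {ω | ∀ i ≤ j, x i ω = y i}
        = ⋃ v : X, {ω | ∀ i ≤ j + 1, x i ω = Function.update y (j + 1) v i} := by
      ext ω
      simp only [Set.mem_ofPred_eq, Set.mem_iUnion]
      constructor
      · intro h
        refine ⟨x (j + 1) ω, fun i hi => ?_⟩
        rcases eq_or_ne i (j + 1) with rfl | hne
        · rw [Function.update_self]
        · rw [Function.update_of_ne hne]
          exact h i (by omega)
      · rintro ⟨v, h⟩ i hi
        rw [h i (by omega), Function.update_of_ne (by omega)]
    have hdisj : Pairwise (Function.onFun Disjoint fun v : X =>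
        {ω | ∀ i ≤ j + 1, x i ω = Function.update y (j + 1) v i}) := by
      intro v v' hv
      refine Set.disjoint_left.2 fun ω h h' => hv ?_
      have e := h (j + 1) le_rfl
      have e' := h' (j + 1) le_rfl
      rw [Function.update_self] at e e'
      rw [← e, e']
    rw [hset, lintegral_iUnion (fun v => measurableSet_path_prefix hx _ _) hdisj, tsum_fintype]
    simp only [pathExp]
    rw [Finset.mul_sum, ENNReal.ofReal_sum_of_nonneg]
    · refine Finset.sum_congr rfl fun v _ => ?_
      rw [ih (j + 1) (by rwa [show j + 1 + d = j + (d + 1) by omega])]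
      congr 1
      rw [Finset.prod_range_succ, Function.update_self, Function.update_of_ne (by omega : j ≠ j + 1),
        Function.update_of_ne (by omega : 0 ≠ j + 1)]
      have hprod : ∏ i ∈ Finset.range j, P (Function.update y (j + 1) v i)
          (Function.update y (j + 1) v (i + 1)) = ∏ i ∈ Finset.range j, P (y i) (y (i + 1)) := by
        refine Finset.prod_congr rfl fun i hi => ?_
        have := Finset.mem_range.1 hi
        rw [Function.update_of_ne (by omega), Function.update_of_ne (by omega)]
      rw [hprod]
      simp only [pathGlue_pathCons j y _ v]
      ring
    · intro v _
      refine mul_nonneg (mul_nonneg (hμ _) (Finset.prod_nonneg fun i _ => hP.1 _ _))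
        (mul_nonneg (hP.1 _ _) (pathExp_nonneg hP d (fun ξ => hG0 _) v))

theorem IsMarkovChain.setLIntegral_start (hM : IsMarkovChain Pr P μ x)
    (hx : ∀ k, Measurable (x k)) (hP : P ∈ Matrix.rowStochastic ℝ X) (hμ : ∀ y, 0 ≤ μ y)
    {G : (ℕ → X) → ℝ} (hG0 : ∀ ξ, 0 ≤ G ξ) {n : ℕ} (hG : DependsOn G (Set.Iic n)) (y : X) :
    ∫⁻ ω in x 0 ⁻¹' {y}, ENNReal.ofReal (G fun k => x k ω) ∂Pr
      = ENNReal.ofReal (μ y * pathExp P n G y) := by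
  have := hM.setLIntegral_prefix hx hP hμ hG0 n 0 (by rwa [zero_add]) fun _ => y
  have hset : {ω | ∀ i ≤ 0, x i ω = y} = x 0 ⁻¹' {y} := by
    ext ω
    simp
  have hglue : ∀ ξ : ℕ → X, pathGlue 0 (fun _ => y) ξ = ξ := fun ξ => by
    funext i
    simp [pathGlue]
  simpa only [hset, hglue, Finset.range_zero, Finset.prod_empty, mul_one] using this

/-- If `Q` is independent of the future of the chain given its initial state, and the expectation of
`G` is at most `θ` from every initial state, then `E[U(Q) G(x)] ≤ E[U(Q)] θ`. -/
theorem IsMarkovChain.lintegral_mul_le [IsProbabilityMeasure Pr] (hM : IsMarkovChain Pr P μ x)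
    (hx : ∀ k, Measurable (x k)) (hP : P ∈ Matrix.rowStochastic ℝ X) (hμ : ∀ y, 0 ≤ μ y)
    {E : Type*} [MeasurableSpace E] {Q : Ω → E} (hQ : Measurable Q)
    (hind : ∀ y, IndepFun Q (fun ω k => x (k + 1) ω) (Pr[|x 0 ⁻¹' {y}]))
    {U : E → ℝ≥0∞} (hU : Measurable U) {G : (ℕ → X) → ℝ} (hGm : Measurable G)
    (hG0 : ∀ ξ, 0 ≤ G ξ) {n : ℕ} (hG : DependsOn G (Set.Iic n)) {θ : ℝ}
    (hθ : ∀ y, pathExp P n G y ≤ θ) :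
    ∫⁻ ω, U (Q ω) * ENNReal.ofReal (G fun k => x k ω) ∂Pr
      ≤ (∫⁻ ω, U (Q ω) ∂Pr) * ENNReal.ofReal θ := by
  have hms : ∀ y, MeasurableSet (x 0 ⁻¹' {y}) := fun y => hx 0 (measurableSet_singleton y)
  have hdisj : Pairwise (Function.onFun Disjoint fun y => x 0 ⁻¹' {y}) := by
    intro v v' hv
    exact Set.disjoint_left.2 fun ω h h' => hv (h.symm.trans h')
  have hsplit : ∀ F : Ω → ℝ≥0∞, ∫⁻ ω, F ω ∂Pr = ∑ y, ∫⁻ ω in x 0 ⁻¹' {y}, F ω ∂Pr := by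
    intro F
    rw [← tsum_fintype (L := .unconditional X), ← lintegral_iUnion hms hdisj,
      ← Set.preimage_iUnion, Set.iUnion_of_singleton, Set.preimage_univ, Measure.restrict_univ]
  rw [hsplit, hsplit, Finset.sum_mul]
  refine Finset.sum_le_sum fun y _ => ?_
  by_cases h0 : Pr (x 0 ⁻¹' {y}) = 0
  · simp [Measure.restrict_eq_zero.2 h0]
  have hfin : Pr (x 0 ⁻¹' {y}) ≠ ∞ := measure_ne_top _ _
  have hrestr : Pr.restrict (x 0 ⁻¹' {y}) = Pr (x 0 ⁻¹' {y}) • Pr[|x 0 ⁻¹' {y}] := by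
    rw [ProbabilityTheory.cond, smul_smul, ENNReal.mul_inv_cancel h0 hfin, one_smul]
  have htail : Measurable fun ω k => x (k + 1) ω := measurable_pi_iff.2 fun k => hx (k + 1)
  have hcons : Measurable fun ξ : ℕ → X => pathCons y ξ := by
    refine measurable_pi_iff.2 fun k => ?_
    cases k with
    | zero => exact measurable_const
    | succ k => exact measurable_pi_apply k
  have hV : Measurable fun ξ : ℕ → X => ENNReal.ofReal (G (pathCons y ξ)) :=
    (hGm.comp hcons).ennreal_ofReal
  -- On `x₀ = y` the functional depends on the future `x₁, x₂, …` alone, which is conditionally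
  -- independent of `Q`.
  have heq : ∀ ω ∈ x 0 ⁻¹' {y}, G (fun k => x k ω) = G (pathCons y fun k => x (k + 1) ω) := by
    intro ω hω
    congr 1
    funext k
    cases k with
    | zero => exact hω
    | succ k => rfl
  have hG1 : ∫⁻ ω in x 0 ⁻¹' {y}, ENNReal.ofReal (G (pathCons y fun k => x (k + 1) ω)) ∂Pr
      ≤ Pr (x 0 ⁻¹' {y}) * ENNReal.ofReal θ := by
    rw [← setLIntegral_congr_fun (hms y) fun ω hω => congrArg ENNReal.ofReal (heq ω hω),
      hM.setLIntegral_start hx hP hμ hG0 hG, hM.measure_start, ← ENNReal.ofReal_mul (hμ y)]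
    exact ENNReal.ofReal_le_ofReal (mul_le_mul_of_nonneg_left (hθ y) (hμ y))
  rw [setLIntegral_congr_fun (hms y) fun ω hω =>
    congrArg (fun r => U (Q ω) * ENNReal.ofReal r) (heq ω hω)]
  rw [hrestr, lintegral_smul_measure] at hG1
  have hmul : ∫⁻ ω, U (Q ω) * ENNReal.ofReal (G (pathCons y fun k => x (k + 1) ω))
        ∂Pr[|x 0 ⁻¹' {y}]
      = (∫⁻ ω, U (Q ω) ∂Pr[|x 0 ⁻¹' {y}]) *
        ∫⁻ ω, ENNReal.ofReal (G (pathCons y fun k => x (k + 1) ω)) ∂Pr[|x 0 ⁻¹' {y}] :=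
    lintegral_mul_eq_lintegral_mul_lintegral_of_indepFun'' (hU.comp hQ).aemeasurable
      (hV.comp htail).aemeasurable ((hind y).comp hU hV)
  rw [hrestr, lintegral_smul_measure, lintegral_smul_measure, hmul]
  simp only [smul_eq_mul] at hG1 ⊢
  rw [mul_assoc]
  refine mul_le_mul_right ?_ _
  refine mul_le_mul_right ?_ _
  exact (ENNReal.mul_le_mul_iff_right h0 hfin).1 hG1

end Transfer

/-! ### Contraction in mean over blocks -/

namespace MDP

variable {S A : Type*} [Fintype S] [Fintype A] {M : MDP S A}

instance : DiscreteMeasurableSpace M.Transition := ⟨fun _ => trivial⟩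

section Blocks

variable [DecidableEq S] [DecidableEq A]

theorem dataMatrix_mem_rowStochastic (π : Policy S A) :
    M.dataMatrix π ∈ Matrix.rowStochastic ℝ M.Transition := by
  rw [Matrix.mem_rowStochastic_iff_sum]
  refine ⟨fun x y => ?_, fun x => ?_⟩
  · unfold dataMatrix
    split_ifs
    · exact mul_nonneg ((π.prob_mem _).1 _) ((M.T_mem _ _).1 _)
    · exact le_rfl
  · have h := M.sum_transition fun y => if y.1 = x.next then π.prob y.1 y.2.1 else 0
    have e : ∀ y : M.Transition, M.dataMatrix π x y
        = (if y.1.1 = x.next then π.prob y.1.1 y.1.2.1 else 0) * M.T y.state y.action y.next := by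
      intro y
      rw [ite_mul, zero_mul]
      rfl
    simp only [e]
    rw [h]
    simp only [← Finset.mul_sum, (M.T_mem _ _).2, mul_one]
    rw [Finset.sum_eq_single x.next]
    · simp [(π.prob_mem x.next).2]
    · intro s _ hs
      simp [hs]
    · simp

theorem sum_mul_visit (μ : M.Transition → ℝ) (z : S × A) :
    ∑ u, μ u * visit z u = M.stateActionLaw μ z := by
  simp only [visit, stateActionLaw, mul_ite, mul_one, mul_zero]

theorem sum_stateActionLaw (μ : M.Transition → ℝ) :
    ∑ z, M.stateActionLaw μ z = ∑ u, μ u := by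
  simp only [stateActionLaw]
  rw [Finset.sum_comm]
  simp

/-- Each pair contributes at most `(128/p)(t/(n - t) + δ)`, and there are at most `1/p` pairs
because their probabilities sum to `1`. -/
theorem pathExp_visitDeviation_le (π : Policy S A) {μ : M.Transition → ℝ}
    (hμ : μ ∈ stdSimplex ℝ M.Transition) {t n : ℕ} {δ p : ℝ}
    (hmix : ∀ y, tvDist ((M.dataMatrix π ^ t) y) μ ≤ δ) (hδ : 0 ≤ δ) (hδp : δ ≤ p) (hp : 0 < p)
    (hν : ∀ z, p ≤ M.stateActionLaw μ z) (htn : t < n) (y : M.Transition) :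
    pathExp (M.dataMatrix π) n (visitDeviation (M.stateActionLaw μ) t n) y
      ≤ 128 / p ^ 2 * (t / (n - t : ℕ) + δ) := by
  have hsum : ∑ z, M.stateActionLaw μ z = 1 := (sum_stateActionLaw μ).trans hμ.2
  have hm : (0 : ℝ) < (n - t : ℕ) := by exact_mod_cast Nat.sub_pos_of_lt htn
  have hcard : (Fintype.card (S × A) : ℝ) * p ≤ 1 := by
    rw [← hsum, ← nsmul_eq_mul]
    simpa using Finset.card_nsmul_le_sum Finset.univ (M.stateActionLaw μ) p fun z _ => hν z
  have hD : visitDeviation (M := M) (M.stateActionLaw μ) t n = fun ξ => ∑ z,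
      16 / ((n - t : ℕ) * M.stateActionLaw μ z) ^ 2 *
        (∑ i ∈ Finset.Ico t n, (visit z (ξ i) - M.stateActionLaw μ z)) ^ 2 := rfl
  rw [hD, pathExp_sum]
  have hterm : ∀ z ∈ Finset.univ, pathExp (M.dataMatrix π) n (fun ξ =>
      16 / ((n - t : ℕ) * M.stateActionLaw μ z) ^ 2 *
        (∑ i ∈ Finset.Ico t n, (visit z (ξ i) - M.stateActionLaw μ z)) ^ 2) y
      ≤ 128 / p * (t / (n - t : ℕ) + δ) := by
    intro z _
    have hz : 0 < M.stateActionLaw μ z := hp.trans_le (hν z)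
    have hz1 : M.stateActionLaw μ z ≤ 1 := by
      rw [← hsum]
      exact Finset.single_le_sum (fun z _ => hp.le.trans (hν z)) (Finset.mem_univ z)
    have h2 := pathExp_sq_centered_count_le (dataMatrix_mem_rowStochastic π) (f := visit z)
      (fun u => by unfold visit; split_ifs <;> norm_num)
      (fun u => by unfold visit; split_ifs <;> norm_num)
      (sum_mul_visit μ z) hmix hδ (hδp.trans (hν z)) hz1 n y
    rw [pathExp_const_mul]
    refine (mul_le_mul_of_nonneg_left h2 (by positivity)).trans ?_
    have e : 16 / ((n - t : ℕ) * M.stateActionLaw μ z) ^ 2 *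
        (8 * M.stateActionLaw μ z * ((n - t : ℕ) * t + (n - t : ℕ) ^ 2 * δ))
        = 128 / M.stateActionLaw μ z * (t / (n - t : ℕ) + δ) := by
      field_simp
      ring
    rw [e]
    have := hν z
    gcongr
  refine (Finset.sum_le_sum hterm).trans ?_
  rw [Finset.sum_const, Finset.card_univ, nsmul_eq_mul]
  have hK : 0 ≤ 128 / p ^ 2 * (t / (n - t : ℕ) + δ) := by positivity
  calc (Fintype.card (S × A) : ℝ) * (128 / p * (t / (n - t : ℕ) + δ))
      = (Fintype.card (S × A) * p) * (128 / p ^ 2 * (t / (n - t : ℕ) + δ)) := by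
        field_simp
    _ ≤ _ := mul_le_of_le_one_left hK hcard

theorem dependsOn_blockFactor (κ : ℝ) (ν : S × A → ℝ) (t n : ℕ) :
    DependsOn (blockFactor (M := M) κ ν t n) (Set.Iic n) := by
  intro ξ ζ h
  unfold blockFactor visitDeviation
  have : ∀ z, ∀ i ∈ Finset.Ico t n, visit z (ξ i) - ν z = visit z (ζ i) - ν z := by
    intro z i hi
    rw [h i (Finset.mem_Ico.1 hi).2.le]
  simp only [Finset.sum_congr rfl (this _)]

theorem measurable_blockFactor (κ : ℝ) (ν : S × A → ℝ) (t n : ℕ) :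
    Measurable (blockFactor (M := M) κ ν t n) := by
  have : ∀ z i, Measurable fun ξ : ℕ → M.Transition => visit z (ξ i) := fun z i =>
    (measurable_of_countable (visit (M := M) z)).comp (measurable_pi_apply i)
  unfold blockFactor visitDeviation
  fun_prop

theorem pathExp_blockFactor (π : Policy S A) (κ : ℝ) (ν : S × A → ℝ) (t n : ℕ)
    (y : M.Transition) : pathExp (M.dataMatrix π) n (blockFactor κ ν t n) y
      = 1 - κ * (1 - pathExp (M.dataMatrix π) n (visitDeviation ν t n) y) := by
  have e : blockFactor (M := M) κ ν t n = fun ξ => (1 - κ) + κ * visitDeviation ν t n ξ := by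
    funext ξ
    unfold blockFactor
    ring
  rw [e, pathExp_add, pathExp_const (dataMatrix_mem_rowStochastic π), pathExp_const_mul]
  ring

/-- The product of the block factors over the first `B` blocks. -/
noncomputable def blockProduct (κ : ℝ) (ν : S × A → ℝ) (t n B : ℕ) (ξ : ℕ → M.Transition) : ℝ :=
  ∏ b ∈ Finset.range B, blockFactor κ ν t n (pathShift (b * n) ξ)

theorem blockProduct_succ (κ : ℝ) (ν : S × A → ℝ) (t n B : ℕ) (ξ : ℕ → M.Transition) :
    blockProduct κ ν t n (B + 1) ξ
      = blockFactor κ ν t n ξ * blockProduct κ ν t n B (pathShift n ξ) := by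
  unfold blockProduct
  rw [Finset.prod_range_succ', mul_comm, zero_mul, pathShift_zero]
  congr 1
  refine Finset.prod_congr rfl fun b _ => ?_
  congr 1
  funext i
  simp only [pathShift]
  congr 1
  ring

theorem blockProduct_nonneg {κ : ℝ} (h0 : 0 ≤ κ) (h1 : κ ≤ 1) (ν : S × A → ℝ) (t n B : ℕ)
    (ξ : ℕ → M.Transition) : 0 ≤ blockProduct κ ν t n B ξ :=
  Finset.prod_nonneg fun _ _ => blockFactor_nonneg h0 h1 ν t n _

theorem dependsOn_blockProduct (κ : ℝ) (ν : S × A → ℝ) (t n B : ℕ) :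
    DependsOn (blockProduct (M := M) κ ν t n B) (Set.Iic (B * n)) := by
  intro ξ ζ h
  refine Finset.prod_congr rfl fun b hb => dependsOn_blockFactor κ ν t n fun i hi => h _ ?_
  have : b + 1 ≤ B := Finset.mem_range.1 hb
  have hi : i ≤ n := hi
  show b * n + i ≤ B * n
  nlinarith [Nat.mul_le_mul_right n this]

theorem measurable_blockProduct (κ : ℝ) (ν : S × A → ℝ) (t n B : ℕ) :
    Measurable (blockProduct (M := M) κ ν t n B) := by
  unfold blockProduct
  refine Finset.measurable_prod _ fun b _ => (measurable_blockFactor κ ν t n).comp ?_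
  exact measurable_pi_iff.2 fun i => measurable_pi_apply (b * n + i)

/-- Conditionally on the first block, the remaining ones have mean at most `θ ^ B` whatever the
state at time `n`; this is where uniformity of `hθ` in the starting state is needed. -/
theorem pathExp_blockProduct_le (π : Policy S A) {κ θ : ℝ} (h0 : 0 ≤ κ) (h1 : κ ≤ 1)
    (hθ0 : 0 ≤ θ) (ν : S × A → ℝ) (t n : ℕ)
    (hθ : ∀ y : M.Transition, pathExp (M.dataMatrix π) n (blockFactor κ ν t n) y ≤ θ) (B : ℕ)
    (y : M.Transition) :
    pathExp (M.dataMatrix π) (B * n) (blockProduct κ ν t n B) y ≤ θ ^ B := by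
  have hP := dataMatrix_mem_rowStochastic (M := M) π
  induction B generalizing y with
  | zero =>
    have e : blockProduct (M := M) κ ν t n 0 = fun _ => 1 := by
      funext ξ
      simp [blockProduct]
    rw [e, pathExp_const hP, pow_zero]
  | succ B ih =>
    have e : blockProduct (M := M) κ ν t n (B + 1) = fun ξ =>
        blockFactor κ ν t n ξ * blockProduct κ ν t n B (pathShift n ξ) :=
      funext fun ξ => blockProduct_succ κ ν t n B ξ
    rw [e, show (B + 1) * n = n + B * n by ring,
      pathExp_mul_shift n (B * n) (dependsOn_blockFactor κ ν t n)]
    calc _ ≤ pathExp (M.dataMatrix π) n (fun ξ => θ ^ B * blockFactor κ ν t n ξ) y := by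
          refine pathExp_mono hP n (fun ξ => ?_) y
          rw [mul_comm]
          exact mul_le_mul_of_nonneg_right (ih _) (blockFactor_nonneg h0 h1 ν t n ξ)
      _ = θ ^ B * pathExp (M.dataMatrix π) n (blockFactor κ ν t n) y := pathExp_const_mul _ _ _ _
      _ ≤ θ ^ B * θ := mul_le_mul_of_nonneg_left (hθ y) (pow_nonneg hθ0 B)
      _ = _ := (pow_succ θ B).symm

theorem norm_qLearning_sub_sq_le_blockProduct [Nonempty A] {α : ℝ} (h0 : 0 ≤ α) (h1 : α ≤ 1)
    {ν : S × A → ℝ} {p a : ℝ} (hp : 0 < p) (hν : ∀ z, p ≤ ν z) {t n : ℕ} (htn : t < n)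
    (ha : a = α * (3 / 4 * ((n - t : ℕ) * p))) (ha1 : a ≤ 1)
    (hκ0 : 0 ≤ (1 - M.γ) * (a * (1 - a))) (hκ1 : (1 - M.γ) * (a * (1 - a)) ≤ 1)
    (B : ℕ) (ξ : ℕ → M.Transition) (q q' : S × A → ℝ) :
    ‖M.qLearning α ξ q (B * n) - M.qLearning α ξ q' (B * n)‖ ^ 2
      ≤ blockProduct ((1 - M.γ) * (a * (1 - a))) ν t n B ξ * ‖q - q'‖ ^ 2 := by
  induction B generalizing ξ q q' with
  | zero => simp [blockProduct, qLearning]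
  | succ B ih =>
    rw [show (B + 1) * n = n + B * n by ring, qLearning_add, qLearning_add, blockProduct_succ]
    refine (ih _ _ _).trans ?_
    have := mul_le_mul_of_nonneg_left
      (norm_qLearning_sub_sq_le_blockFactor h0 h1 hp hν htn ha ha1 ξ q q')
      (blockProduct_nonneg hκ0 hκ1 ν t n B (pathShift n ξ))
    linarith

/-- The mean-square contraction of coupled Q-learning over `B` blocks of length `n`, given a bound
`θ` for the mean of a single block factor. -/
theorem lintegral_qLearning_sub_sq_le [Nonempty A] (π : Policy S A) {μ : M.Transition → ℝ}
    (hμ : μ ∈ stdSimplex ℝ M.Transition) {Ω : Type*} [MeasurableSpace Ω] {Pr : Measure Ω}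
    [IsProbabilityMeasure Pr] {x : ℕ → Ω → M.Transition} {q₁ q₂ : Ω → S × A → ℝ}
    (hx : ∀ k, Measurable (x k)) (hM : IsMarkovChain Pr (M.dataMatrix π) μ x)
    (hq₁ : Measurable q₁) (hq₂ : Measurable q₂)
    (hind : ∀ y : M.Transition,
      IndepFun (fun ω => (q₁ ω, q₂ ω)) (fun ω k => x (k + 1) ω) (Pr[|x 0 ⁻¹' {y}]))
    {α : ℝ} (h0 : 0 ≤ α) (h1 : α ≤ 1)
    {ν : S × A → ℝ} {p a θ : ℝ} (hp : 0 < p) (hν : ∀ z, p ≤ ν z) {t n : ℕ} (htn : t < n)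
    (ha : a = α * (3 / 4 * ((n - t : ℕ) * p))) (ha1 : a ≤ 1)
    (hκ0 : 0 ≤ (1 - M.γ) * (a * (1 - a))) (hκ1 : (1 - M.γ) * (a * (1 - a)) ≤ 1) (hθ0 : 0 ≤ θ)
    (hθ : ∀ y : M.Transition, pathExp (M.dataMatrix π) n
      (blockFactor ((1 - M.γ) * (a * (1 - a))) ν t n) y ≤ θ) {B k : ℕ} (hk : B * n ≤ k) :
    ∫⁻ ω, ‖M.qLearning α (fun j => x j ω) (q₁ ω) k
        - M.qLearning α (fun j => x j ω) (q₂ ω) k‖ₑ ^ 2 ∂Pr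
      ≤ (∫⁻ ω, ‖q₁ ω - q₂ ω‖ₑ ^ 2 ∂Pr) * ENNReal.ofReal (θ ^ B) := by
  have hU : Measurable fun q : (S × A → ℝ) × (S × A → ℝ) => ‖q.1 - q.2‖ₑ ^ 2 := by fun_prop
  refine le_trans (lintegral_mono fun ω => ?_)
    (hM.lintegral_mul_le hx (dataMatrix_mem_rowStochastic π) hμ.1 (hq₁.prodMk hq₂) hind hU
      (measurable_blockProduct _ ν t n B) (blockProduct_nonneg hκ0 hκ1 ν t n B)
      (dependsOn_blockProduct _ ν t n B) (pathExp_blockProduct_le π hκ0 hκ1 hθ0 ν t n hθ B))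
  -- Beyond the last complete block only nonexpansiveness is used.
  have hmono : ‖M.qLearning α (fun j => x j ω) (q₁ ω) k
      - M.qLearning α (fun j => x j ω) (q₂ ω) k‖
      ≤ ‖M.qLearning α (fun j => x j ω) (q₁ ω) (B * n)
        - M.qLearning α (fun j => x j ω) (q₂ ω) (B * n)‖ := by
    obtain ⟨r, rfl⟩ := Nat.exists_eq_add_of_le hk
    rw [qLearning_add, qLearning_add]
    exact norm_qLearning_sub_le h0 h1 _ _ _ _
  have hreal := (pow_le_pow_left₀ (norm_nonneg _) hmono 2).trans
    (norm_qLearning_sub_sq_le_blockProduct h0 h1 hp hν htn ha ha1 hκ0 hκ1 B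
      (fun j => x j ω) (q₁ ω) (q₂ ω))
  have := ENNReal.ofReal_le_ofReal hreal
  rw [ENNReal.ofReal_mul (blockProduct_nonneg hκ0 hκ1 ν t n B _),
    ENNReal.ofReal_pow (norm_nonneg _), ENNReal.ofReal_pow (norm_nonneg _), ofReal_norm,
    ofReal_norm, mul_comm] at this
  exact this

end Blocks

end MDP

/-! ### The choice of the block length -/

/-- For a block of length about `1 / (10 α)`, the mean block factor is at most `ρ ^ n`, with
`ρ = 1 - g p α / 2`, and `ρ ^ n` is bounded below. -/
theorem exists_block_length {α g p : ℝ} {t : ℕ} (hα : 0 < α) (hg0 : 0 < g) (hg1 : g ≤ 1)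
    (hp0 : 0 < p) (hp1 : p ≤ 1) (ht : 1 ≤ t) (h : α * t ≤ p ^ 2 / 20000) :
    ∃ n : ℕ, t < n ∧ ∃ a : ℝ, a = α * (3 / 4 * ((n - t : ℕ) * p)) ∧ a ≤ 1 ∧
      0 ≤ g * (a * (1 - a)) ∧ g * (a * (1 - a)) ≤ 1 ∧
      (∀ D : ℝ, D ≤ 128 / p ^ 2 * (t / (n - t : ℕ) + α) →
        1 - g * (a * (1 - a)) * (1 - D) ≤ (1 - g * p * α / 2) ^ n) ∧
      1 / 12 ≤ (1 - g * p * α / 2) ^ n := by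
  have hp2 : 0 < p ^ 2 := by positivity
  have hp21 : p ^ 2 ≤ 1 := pow_le_one₀ hp0.le hp1
  have hαt : α ≤ α * t := le_mul_of_one_le_right hα.le (by exact_mod_cast ht)
  have hn1 : 1 / (10 * α) ≤ ⌈1 / (10 * α)⌉₊ := Nat.le_ceil _
  have hn2 : (⌈1 / (10 * α)⌉₊ : ℝ) < 1 / (10 * α) + 1 := Nat.ceil_lt_add_one (by positivity)
  have hinv : α * (1 / (10 * α)) = 1 / 10 := by field_simp
  set n := ⌈1 / (10 * α)⌉₊
  have hαn1 : 1 / 10 ≤ α * n := by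
    rw [← hinv]
    exact mul_le_mul_of_nonneg_left hn1 hα.le
  have hαn2 : α * n ≤ 11 / 100 := by
    have := mul_le_mul_of_nonneg_left hn2.le hα.le
    rw [mul_add, hinv] at this
    linarith
  have htn : t < n := by
    have : α * (t : ℝ) < α * n := by linarith
    exact_mod_cast lt_of_mul_lt_mul_left this hα.le
  have hcast : ((n - t : ℕ) : ℝ) = n - t := Nat.cast_sub htn.le
  have hm0 : (0 : ℝ) < (n - t : ℕ) := by exact_mod_cast Nat.sub_pos_of_lt htn
  set m : ℝ := ((n - t : ℕ) : ℝ)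
  have hαm : α * m = α * n - α * t := by rw [hcast]; ring
  have hαm1 : 99 / 100 * (α * n) ≤ α * m := by linarith
  have hαm2 : α * m ≤ 11 / 100 := by
    have : 0 < α * t := hα.trans_le hαt
    linarith
  have hu : 0 < g * p := mul_pos hg0 hp0
  have hu1 : g * p ≤ 1 := mul_le_one₀ hg1 hp0.le hp1
  -- Bernoulli bounds `ρ ^ n` from below, which serves both final claims: the mean factor need only
  -- lie below this linear expression, and `α n ≤ 11/100` keeps it above `1/12`.
  have hbern : 1 - g * p * (α * n) / 2 ≤ (1 - g * p * α / 2) ^ n := by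
    have := one_add_mul_le_pow (show (-2 : ℝ) ≤ -(g * p * α / 2) by
      have := mul_le_one₀ hu1 hα.le (show α ≤ 1 by linarith)
      linarith) n
    rw [← sub_eq_add_neg] at this
    linarith
  obtain ⟨a, ha⟩ : ∃ a, a = α * (3 / 4 * (m * p)) := ⟨_, rfl⟩
  have ha' : a = 3 / 4 * (α * m) * p := by rw [ha]; ring
  have ha0 : 0 < a := by rw [ha]; positivity
  have ha1 : a ≤ 1 / 10 := by
    rw [ha']
    have := mul_le_mul hαm2 hp1 hp0.le (by norm_num)
    linarith
  have haa : a * (1 - a) ≤ 1 := by nlinarith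
  have haa' : 9 / 10 * a ≤ a * (1 - a) := by nlinarith
  refine ⟨n, htn, a, ha, by linarith, mul_nonneg hg0.le (by linarith),
    mul_le_one₀ hg1 (by linarith) haa, ?_, ?_⟩
  · intro D hD
    have htm : t / m ≤ p ^ 2 / 1900 := by
      rw [div_le_iff₀ hm0]
      have : α * t ≤ α * (p ^ 2 / 1900 * m) := by
        have := mul_le_mul_of_nonneg_left (show 19 / 200 ≤ α * m by linarith)
          (show 0 ≤ p ^ 2 / 1900 by positivity)
        linarith
      exact le_of_mul_le_mul_left this hα
    -- Numerically, `128 (1/1900 + 1/20000) < 1/10`.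
    have hD1 : D ≤ 1 / 10 := by
      refine hD.trans ?_
      rw [div_mul_eq_mul_div, div_le_iff₀ hp2]
      linarith
    refine le_trans ?_ hbern
    have h1 : 9 / 10 * (9 / 10 * a) ≤ (a * (1 - a)) * (1 - D) := by
      have := mul_le_mul haa' (show 9 / 10 ≤ 1 - D by linarith) (by norm_num) (by linarith)
      linarith
    -- The losses still leave more than the required rate: `(9/10)² · (3/4) · (99/100) > 1/2`.
    have h2 : p * (α * n) / 2 ≤ 9 / 10 * (9 / 10 * a) := by
      rw [ha']
      have h3 := mul_le_mul_of_nonneg_right hαm1 hp0.le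
      have h4 : 0 ≤ α * n * p := by positivity
      linarith
    have := mul_le_mul_of_nonneg_left (h2.trans h1) hg0.le
    linarith
  · refine le_trans ?_ hbern
    have := mul_le_mul hu1 hαn2 (by linarith) zero_le_one
    linarith

/-! ### Assembling the mean-square bound -/

theorem proposition1 :
    ∃ c₀ : ℝ, 0 < c₀ ∧
      ∀ (S A : Type*) [Fintype S] [Fintype A] [DecidableEq S] [DecidableEq A]
        [Nonempty S] [Nonempty A] (M : MDP S A) (π : Policy S A)
        (μ : M.Transition → ℝ) (α : ℝ)
        (Ω : Type*) [MeasurableSpace Ω] (Pr : Measure Ω) [IsProbabilityMeasure Pr]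
        (x : ℕ → Ω → M.Transition) (q₁ q₂ : Ω → S × A → ℝ),
        -- the data stream is an irreducible, aperiodic, stationary Markov chain
        (M.dataMatrix π).IsIrreducible →
        IsAperiodic (M.dataMatrix π) →
        IsStationaryDist (M.dataMatrix π) μ →
        (∀ k, Measurable (x k)) →
        IsMarkovChain Pr (M.dataMatrix π) μ x →
        -- given `x₀`, the initial iterates are independent of `x₁, x₂, …`
        Measurable q₁ →
        Measurable q₂ →
        (∀ y : M.Transition,
          IndepFun (fun ω => (q₁ ω, q₂ ω)) (fun ω k => x (k + 1) ω) (Pr[|x 0 ⁻¹' {y}])) →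
        -- the stepsize
        0 < α →
        1 ≤ mixingTime (M.dataMatrix π) μ α →
        α * mixingTime (M.dataMatrix π) μ α ≤
          c₀ * (1 - M.contractionFactor μ) ^ 2 /
            Real.log (Fintype.card S * Fintype.card A) →
        ∀ k : ℕ, mixingTime (M.dataMatrix π) μ α ≤ k →
          ∫⁻ ω, ‖M.qLearning α (fun j => x j ω) (q₁ ω) k
              - M.qLearning α (fun j => x j ω) (q₂ ω) k‖ₑ ^ 2 ∂Pr ≤
            12 * (∫⁻ ω, ‖q₁ ω - q₂ ω‖ₑ ^ 2 ∂Pr) *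
              ENNReal.ofReal ((1 - (1 - M.contractionFactor μ) * α / 2) ^
                (k - mixingTime (M.dataMatrix π) μ α)) := by
  refine ⟨1 / 40000, by norm_num, ?_⟩
  intro S A _ _ _ _ _ _ M π μ α Ω _ Pr _ x q₁ q₂ _ _ hstat hx hM hq₁ hq₂ hind hα ht hαt k hk
  obtain ⟨t, htdef⟩ : ∃ t, t = mixingTime (M.dataMatrix π) μ α := ⟨_, rfl⟩
  rw [← htdef] at ht hαt hk ⊢
  have hmix : ∀ y, tvDist ((M.dataMatrix π ^ t) y) μ ≤ α := by
    -- The infimum of the empty set of naturals is `0`, so `1 ≤ t` already shows that the mixing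
    -- level is reached.
    have hne : {k : ℕ | ∀ y, tvDist ((M.dataMatrix π ^ k) y) μ ≤ α}.Nonempty := by
      refine Nat.nonempty_of_pos_sInf ?_
      rw [htdef] at ht
      exact ht
    rw [htdef]
    exact Nat.sInf_mem hne
  obtain ⟨p, hpdef⟩ : ∃ p, p = Finset.univ.inf' Finset.univ_nonempty (M.stateActionLaw μ) :=
    ⟨_, rfl⟩
  have hν : ∀ z, p ≤ M.stateActionLaw μ z := fun z => by
    rw [hpdef]
    exact Finset.inf'_le _ (Finset.mem_univ z)
  have hβ : 1 - M.contractionFactor μ = (1 - M.γ) * p := by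
    rw [MDP.contractionFactor, hpdef]
    ring
  rw [hβ] at hαt ⊢
  have hlaw := (M.isStationaryDist_stateActionLaw π μ hstat).1
  have hp0' : 0 ≤ p := by
    rw [hpdef]
    exact Finset.le_inf' _ _ fun z _ => hlaw.1 z
  have hp1 : p ≤ 1 := by
    obtain ⟨z⟩ : Nonempty (S × A) := inferInstance
    refine (hν z).trans ?_
    rw [← hlaw.2]
    exact Finset.single_le_sum (fun z _ => hlaw.1 z) (Finset.mem_univ z)
  have hg0 := sub_pos.2 M.γ_lt_one
  have hg1 : 1 - M.γ ≤ 1 := by linarith [M.γ_pos]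
  have hαt0 : 0 < α * t := mul_pos hα (by exact_mod_cast ht)
  have hlog : 1 / 2 ≤ Real.log (Fintype.card S * Fintype.card A) := by
    -- With a single pair the logarithm is `0`, division by it gives `0`, and the stepsize condition
    -- contradicts `α t > 0`.
    have hN : 2 ≤ Fintype.card S * Fintype.card A := by
      by_contra hlt
      have h1 : Fintype.card S * Fintype.card A = 1 := by
        have := Nat.mul_pos (Fintype.card_pos (α := S)) (Fintype.card_pos (α := A))
        omega
      have h1' : (Fintype.card S : ℝ) * Fintype.card A = 1 := by exact_mod_cast h1
      rw [h1', Real.log_one, div_zero] at hαt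
      linarith
    have hN' : (2 : ℝ) ≤ Fintype.card S * Fintype.card A := by exact_mod_cast hN
    linarith [Real.log_two_gt_d9, Real.log_le_log two_pos hN']
  -- The logarithm is only used through `log ≥ 1/2`, which turns the constant `1/40000` into
  -- `1/20000`.
  have hle : α * t ≤ p ^ 2 / 20000 := by
    refine hαt.trans ?_
    rw [div_le_iff₀ (by linarith)]
    have h1 : ((1 - M.γ) * p) ^ 2 ≤ p ^ 2 :=
      pow_le_pow_left₀ (mul_nonneg hg0.le hp0') (mul_le_of_le_one_left hp0' hg1) 2
    have h2 := mul_le_mul_of_nonneg_left hlog (sq_nonneg p)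
    linarith
  have hp0 : 0 < p := by
    rcases hp0'.lt_or_eq with h | h
    · exact h
    · rw [← h] at hle
      norm_num at hle
      linarith
  have hαp : α ≤ p ^ 2 / 20000 :=
    (le_mul_of_one_le_right hα.le (by exact_mod_cast ht)).trans hle
  obtain ⟨n, htn, a, ha, ha1, hκ0, hκ1, hD, hlow⟩ :=
    exists_block_length hα hg0 hg1 hp0 hp1 ht hle
  set ρ := 1 - (1 - M.γ) * p * α / 2 with hρ
  have hv : 0 ≤ (1 - M.γ) * p * α := by positivity
  have hα1 : α ≤ 1 := by nlinarith
  have hρ0 : 0 ≤ ρ := by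
    have : (1 - M.γ) * p ≤ 1 := by nlinarith
    nlinarith
  have hρ1 : ρ ≤ 1 := by linarith
  have hθ : ∀ y : M.Transition, pathExp (M.dataMatrix π) n
      (MDP.blockFactor ((1 - M.γ) * (a * (1 - a))) (M.stateActionLaw μ) t n) y ≤ ρ ^ n := by
    intro y
    rw [MDP.pathExp_blockFactor]
    exact hD _ (MDP.pathExp_visitDeviation_le π hstat.1 hmix hα.le (by nlinarith) hp0 hν htn y)
  refine (MDP.lintegral_qLearning_sub_sq_le π hstat.1 hx hM hq₁ hq₂ hind hα.le hα1 hp0 hν htn ha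
    ha1 hκ0 hκ1 (pow_nonneg hρ0 n) hθ (Nat.div_mul_le_self k n)).trans ?_
  -- Rounding `k` down to a multiple of `n` loses less than one block, and `12 ρ ^ n ≥ 1` pays for a
  -- whole one.
  have hfin : (ρ ^ n) ^ (k / n) ≤ 12 * ρ ^ (k - t) := by
    have h1 : ρ ^ ((k / n) * n + n) ≤ ρ ^ (k - t) := by
      refine pow_le_pow_of_le_one hρ0 hρ1 ?_
      have h2 := Nat.div_add_mod k n
      have h3 := Nat.mod_lt k (show 0 < n by omega)
      rw [mul_comm n] at h2
      omega
    rw [pow_add, mul_comm (k / n), pow_mul] at h1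
    have h2 := mul_le_mul_of_nonneg_left hlow (pow_nonneg (pow_nonneg hρ0 n) (k / n))
    linarith
  calc (∫⁻ ω, ‖q₁ ω - q₂ ω‖ₑ ^ 2 ∂Pr) * ENNReal.ofReal ((ρ ^ n) ^ (k / n))
      ≤ (∫⁻ ω, ‖q₁ ω - q₂ ω‖ₑ ^ 2 ∂Pr) * ENNReal.ofReal (12 * ρ ^ (k - t)) := by
        gcongr
    _ = _ := by
        rw [ENNReal.ofReal_mul (by norm_num), ENNReal.ofReal_ofNat]
        ring
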